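/- Let $k$ be an algebraically closed field of characteristic zero. An algebraic variety over $k$ means a reduced separated scheme of finite type over $k$. Let $X$ and $Y$ be irreducible algebraic varieties over $k$, with $Y$ normal (all its local rings are integrally closed domains), and let $f\colon X\to Y$ be a morphism over $k$. Then $f$ is an open immersion if and only if $f$ is birational (that is, $f$ restricts to an isomorphism from a dense open subscheme of $X$ onto a dense open subscheme of $Y$) and has finite fibres (that is, $f^{-1}(y)$ is a finite set for every $y\in Y$). -/

import Mathlib

open CategoryTheory AlgebraicGeometry

universe u

namespace ZMT

/-- The structure morphism `s : X ⟶ Spec k` makes `X` an algebraic variety over the field `k`: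
`X` is reduced, and separated and of finite type over `k`. -/
structure IsVariety {k : Type u} [Field k] {X : Scheme.{u}}
    (s : X ⟶ Spec (CommRingCat.of k)) : Prop where
  isReduced : IsReduced X
  isSeparated : IsSeparated s
  locallyOfFiniteType : LocallyOfFiniteType s
  quasiCompact : QuasiCompact s

/-- A scheme is normal if all its local rings are integrally closed domains. -/
def IsNormal (X : Scheme.{u}) : Prop :=
  ∀ x : X, IsDomain (X.presheaf.stalk x) ∧ IsIntegrallyClosed (X.presheaf.stalk x)

/-- A morphism `f : X ⟶ Y` is birational if it restricts to an isomorphism from a dense open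
subscheme of `X` onto a dense open subscheme of `Y`. -/
def IsBirational {X Y : Scheme.{u}} (f : X ⟶ Y) : Prop :=
  ∃ p : X.PartialIso Y, p.iso.hom ≫ p.target.ι = p.source.ι ≫ f

/-- A morphism of schemes has finite fibres if every point of the target has finitely many
preimages. -/
def HasFiniteFibres {X Y : Scheme.{u}} (f : X ⟶ Y) : Prop :=
  ∀ y : Y, (f ⁻¹' {y}).Finite

end ZMT

/-!
Let `f : X ⟶ Y` be birational with finite fibres, where `Y` is normal. Since `f` is separated, of
finite type and quasi-finite, Zariski's main theorem (in Grothendieck's form, which Mathlib provides)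
says that `X` is an open subscheme of the relative normalization of `Y` in `X`. It therefore
suffices that the integral morphism from this normalization to `Y` is an isomorphism
(`ZMT.isIso_fromNormalization`).

This is a statement about affine opens `U` of `Y`: every section `x` of `X` over the preimage of `U`
that is integral over `Γ(Y, U)` comes from `Γ(Y, U)`. As `f` is birational, it induces an
isomorphism of function fields, so `x` is an element of the fraction field of `Γ(Y, U)`, and
`Γ(Y, U)` is integrally closed because `Y` is normal.
-/

namespace ZMT

/-- Integral closedness is a local property, so it passes from the local rings of a normal scheme
to its sections over affine opens. -/
theorem IsNormal.isIntegrallyClosed_section {Y : Scheme.{u}} [IsIntegral Y] (hY : IsNormal Y)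
    {U : Y.Opens} (hU : IsAffineOpen U) [Nonempty U] : IsIntegrallyClosed Γ(Y, U) := by
  refine IsIntegrallyClosed.of_localization_maximal fun P _ hP ↦ ?_
  let P' : PrimeSpectrum Γ(Y, U) := ⟨P, hP.isPrime⟩
  have hy : hU.fromSpec P' ∈ U := hU.range_fromSpec.le ⟨P', rfl⟩
  let := Y.presheaf.algebra_section_stalk ⟨hU.fromSpec P', hy⟩
  have : IsLocalization P.primeCompl (Y.presheaf.stalk (hU.fromSpec P')) :=
    hU.isLocalization_stalk' P' hy
  have := (hY (hU.fromSpec P')).2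
  exact IsIntegrallyClosed.of_equiv (IsLocalization.algEquiv P.primeCompl
    (Y.presheaf.stalk (hU.fromSpec P')) (Localization.AtPrime P)).toRingEquiv

section Birational

variable {X Y : Scheme.{u}} {f : X ⟶ Y}

/-- A birational morphism coincides with an open immersion near the generic point. -/
theorem IsBirational.exists_isOpenImmersion [IrreducibleSpace X] (hf : IsBirational f) :
    ∃ U : X.Opens, genericPoint X ∈ U ∧ IsOpenImmersion (U.ι ≫ f) := by
  obtain ⟨p, hp⟩ := hf
  refine ⟨p.source, ?_, hp ▸ inferInstance⟩
  exact ((genericPoint_spec X).mem_open_set_iff p.source.isOpen).mpr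
    (by simpa using p.dense_source.nonempty)

theorem IsBirational.apply_genericPoint [IsIntegral X] [IrreducibleSpace Y]
    (hf : IsBirational f) : f (genericPoint X) = genericPoint Y := by
  obtain ⟨U, hU, _⟩ := hf.exists_isOpenImmersion
  have : Nonempty U := ⟨⟨_, hU⟩⟩
  rw [← genericPoint_eq_of_isOpenImmersion (U.ι ≫ f), ← genericPoint_eq_of_isOpenImmersion U.ι]
  simp

theorem IsBirational.apply_genericPoint_mem [IsIntegral X] [IrreducibleSpace Y]
    (hf : IsBirational f) (U : Y.Opens) [Nonempty U] : f (genericPoint X) ∈ U := by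
  rw [hf.apply_genericPoint]
  exact ((genericPoint_spec Y).mem_open_set_iff U.isOpen).mpr
    (by simpa using Set.nonempty_coe_sort.mp ‹Nonempty U›)

/-- A birational morphism induces an isomorphism of function fields. -/
theorem IsBirational.isIso_stalkMap_genericPoint [IrreducibleSpace X]
    (hf : IsBirational f) : IsIso (f.stalkMap (genericPoint X)) := by
  obtain ⟨U, hU, _⟩ := hf.exists_isOpenImmersion
  obtain ⟨u, hu⟩ : ∃ u : U.toScheme, U.ι u = genericPoint X := ⟨⟨_, hU⟩, rfl⟩
  have : IsIso ((U.ι ≫ f).stalkMap u) := inferInstance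
  have h : IsIso (f.stalkMap (U.ι u) ≫ U.ι.stalkMap u) :=
    (congrArg IsIso (Scheme.Hom.stalkMap_comp U.ι f u)).mp this
  rw [← hu]
  exact IsIso.of_isIso_comp_right (f.stalkMap (U.ι u)) (U.ι.stalkMap u)

end Birational

/-- A section of `X` over the preimage of `U` which is integral over `Γ(Y, U)` lies in the function
field of `Y`, hence in the integrally closed ring `Γ(Y, U)`. -/
theorem IsBirational.mem_range_of_isIntegralElem {X Y : Scheme.{u}} [IsIntegral X] [IsIntegral Y]
    {f : X ⟶ Y} (hf : IsBirational f) (hY : IsNormal Y) {U : Y.Opens} (hU : IsAffineOpen U)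
    [Nonempty U] {x : Γ(X, f ⁻¹ᵁ U)} (hx : (f.app U).hom.IsIntegralElem x) :
    ∃ a, (f.app U).hom a = x := by
  have hξ := hf.apply_genericPoint_mem U
  have := hf.isIso_stalkMap_genericPoint
  let σ := (asIso (f.stalkMap (genericPoint X))).commRingCatIsoToRingEquiv
  let := Y.presheaf.algebra_section_stalk ⟨f (genericPoint X), hξ⟩
  have : IsFractionRing Γ(Y, U) (Y.presheaf.stalk (f (genericPoint X))) := by
    -- The algebra structure depends on the point, so the equality with the generic point is
    -- substituted for a variable.
    have key (y : Y) (hy : y ∈ U) (h : y = genericPoint Y) :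
        letI := Y.presheaf.algebra_section_stalk ⟨y, hy⟩
        IsFractionRing Γ(Y, U) (Y.presheaf.stalk y) := by
      subst h
      exact functionField_isFractionRing_of_isAffineOpen Y U hU
    exact key _ hξ hf.apply_genericPoint
  have := hY.isIntegrallyClosed_section hU
  have hσ (a : Γ(Y, U)) : σ (algebraMap _ (Y.presheaf.stalk (f (genericPoint X))) a) =
      X.presheaf.germ (f ⁻¹ᵁ U) (genericPoint X) hξ (f.app U a) :=
    Scheme.Hom.germ_stalkMap_apply f U (genericPoint X) hξ a
  have hz : IsIntegral Γ(Y, U) (σ.symm (X.presheaf.germ (f ⁻¹ᵁ U) (genericPoint X) hξ x)) := by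
    obtain ⟨p, hp, hpx⟩ := hx
    refine ⟨p, hp, σ.injective ?_⟩
    have h := congr((X.presheaf.germ (f ⁻¹ᵁ U) (genericPoint X) hξ).hom $hpx)
    rw [Polynomial.hom_eval₂, map_zero] at h
    rw [map_zero, ← h, ← RingEquiv.coe_toRingHom, Polynomial.hom_eval₂]
    congr 1
    · exact RingHom.ext hσ
    · simp
  obtain ⟨a, ha⟩ := IsIntegrallyClosed.algebraMap_eq_of_integral hz
  refine ⟨a, germ_injective_of_isIntegral X (genericPoint X) hξ ?_⟩
  refine (hσ a).symm.trans ?_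
  rw [ha, RingEquiv.apply_symm_apply]

theorem IsBirational.app_injective {X Y : Scheme.{u}} [IsIntegral X] [IsIntegral Y]
    {f : X ⟶ Y} (hf : IsBirational f) (U : Y.Opens) [Nonempty U] :
    Function.Injective (f.app U).hom := by
  have hξ := hf.apply_genericPoint_mem U
  have : Nonempty (f ⁻¹ᵁ U) := ⟨⟨_, hξ⟩⟩
  exact (injective_iff_map_eq_zero _).mpr fun a ha ↦ by
    have := hf.isIso_stalkMap_genericPoint
    refine germ_injective_of_isIntegral Y (f (genericPoint X)) hξ ?_
    apply (asIso (f.stalkMap (genericPoint X))).commRingCatIsoToRingEquiv.injective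
    refine (Scheme.Hom.germ_stalkMap_apply f U (genericPoint X) hξ a).trans ?_
    refine (congr(X.presheaf.germ (f ⁻¹ᵁ U) (genericPoint X) hξ $ha)).trans ?_
    simp

/-- A normal integral scheme is its own relative normalization in any integral scheme that is
birational over it. -/
theorem isIso_fromNormalization {X Y : Scheme.{u}} [IsIntegral X] [IsIntegral Y]
    (f : X ⟶ Y) [QuasiCompact f] [QuasiSeparated f] (hf : IsBirational f) (hY : IsNormal Y) :
    IsIso f.fromNormalization := by
  refine (IsZariskiLocalAtTarget.iff_of_iSup_eq_top (P := .isomorphisms Scheme) _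
    (iSup_affineOpens_eq_top Y)).mpr fun U ↦ ?_
  refine (isIso_morphismRestrict_iff_isIso_app _ U.2).mpr ?_
  rw [f.fromNormalization_app U.2]
  let := (f.app U.1).hom.toAlgebra
  suffices Function.Bijective
      (algebraMap Γ(Y, U.1) (integralClosure Γ(Y, U.1) Γ(X, f ⁻¹ᵁ U.1))) by
    have : IsIso (CommRingCat.ofHom
        (algebraMap Γ(Y, U.1) (integralClosure Γ(Y, U.1) Γ(X, f ⁻¹ᵁ U.1)))) :=
      (ConcreteCategory.isIso_iff_bijective _).mpr this
    exact IsIso.comp_isIso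
  rcases isEmpty_or_nonempty U.1 with hU | hU
  · -- Over the empty open both rings are zero.
    have h : U.1 = ⊥ := by
      ext y
      simpa using fun hy ↦ hU.elim ⟨y, hy⟩
    have : Subsingleton Γ(Y, U.1) := by rw [h]; infer_instance
    have : Subsingleton Γ(X, f ⁻¹ᵁ U.1) := Module.subsingleton Γ(Y, U.1) _
    exact ⟨Function.injective_of_subsingleton _, fun x ↦ ⟨0, Subsingleton.elim _ _⟩⟩
  · refine ⟨fun a b h ↦ hf.app_injective U.1 congr(Subtype.val $h), fun ⟨x, hx⟩ ↦ ?_⟩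
    obtain ⟨a, ha⟩ := hf.mem_range_of_isIntegralElem hY U.2 hx
    exact ⟨a, Subtype.ext ha⟩

theorem isBirational_of_isOpenImmersion {X Y : Scheme.{u}} [Nonempty X] [IrreducibleSpace Y]
    (f : X ⟶ Y) [IsOpenImmersion f] : IsBirational f :=
  ⟨{ source := ⊤
     dense_source := dense_univ
     target := f.opensRange
     dense_target := f.opensRange.isOpen.dense (Set.range_nonempty f)
     iso := X.topIso ≪≫ f.isoOpensRange }, by simp⟩

end ZMT

theorem mainTheorem5 {k : Type u} [Field k] [IsAlgClosed k] [CharZero k]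
    {X Y : Scheme.{u}} (sX : X ⟶ Spec (CommRingCat.of k)) (sY : Y ⟶ Spec (CommRingCat.of k))
    (hX : ZMT.IsVariety sX) (hXirr : IrreducibleSpace X)
    (hY : ZMT.IsVariety sY) (hYirr : IrreducibleSpace Y) (hYnormal : ZMT.IsNormal Y)
    (f : X ⟶ Y) (hf : f ≫ sY = sX) :
    IsOpenImmersion f ↔ ZMT.IsBirational f ∧ ZMT.HasFiniteFibres f := by
  refine ⟨fun _ ↦ ⟨ZMT.isBirational_of_isOpenImmersion f, fun y ↦
    (Set.subsingleton_singleton.preimage f.isOpenEmbedding.injective).finite⟩, ?_⟩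
  rintro ⟨hbir, hfin⟩
  have := hX.isReduced
  have := hY.isReduced
  have : IsIntegral X := isIntegral_of_irreducibleSpace_of_isReduced X
  have : IsIntegral Y := isIntegral_of_irreducibleSpace_of_isReduced Y
  have := hY.isSeparated
  have : IsSeparated (f ≫ sY) := hf ▸ hX.isSeparated
  have : LocallyOfFiniteType (f ≫ sY) := hf ▸ hX.locallyOfFiniteType
  have : QuasiCompact (f ≫ sY) := hf ▸ hX.quasiCompact
  have : IsSeparated f := .of_comp f sY
  have : LocallyOfFiniteType f := locallyOfFiniteType_of_comp f sY
  have : QuasiCompact f := .of_comp f sY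
  have : LocallyQuasiFinite f := .of_finite_preimage_singleton f hfin
  have := ZMT.isIso_fromNormalization f hbir hYnormal
  rw [← f.toNormalization_fromNormalization]
  infer_instance
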